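/- \textbf{Setting.} Let $X$ be a complex Banach space and $0<T<\infty$. Let $(U(t,s))_{t,s\in[-T,T]}\subset B(X)$ be a two-parameter group: $U(t,r)U(r,s)=U(t,s)$ and $U(s,s)=I$ for all $r,s,t\in[-T,T]$; for every $s\in[-T,T]$ and $x\in X$ the map $t\mapsto U(t,s)x$ is continuous on $[s,T]$; and there are real $M,\beta$ with $\|U(t,s)\|\le Me^{\beta t}$ for all $t,s\in[-T,T]$. Let $Y\subset X$ be a dense linear subspace with $U(t,s)Y=Y$ for all $t,s\in[-T,T]$, and let $A(t):Y\to X$, $t\in[-T,T]$, be the infinitesimal generator of $U$ on $Y$, i.e. $A(t)y=\lim_{h\to0}h^{-1}(U(t+h,t)-I)y$ in $X$ for all $y\in Y$ (limit over $h\neq 0$ with $t+h\in[-T,T]$). Consider, for $s\in[-T,T]$, $u_s\in X$ and $f\in L^1(-T,T;X)$, the problem $$\partial_t u(t)=A(t)u(t)+f(t)\quad (t\in[-T,T]),\qquad u(s)=u_s. \tag{1}$$ A strict solution of $\partial_t v=A(t)v+g$, with $g\in C([-T,T];X)$, is a function $v:[-T,T]\to X$ with values in $Y$ which is differentiable in $X$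 and satisfies the equation at every $t\in[-T,T]$ (one-sided derivatives at $\pm T$). A solution of (1) is a function $u\in C([-T,T];X)$ with $u(s)=u_s$ for which there are $g_n\in C([-T,T];X)$ and strict solutions $v_n$ of $\partial_tv_n=A(t)v_n+g_n$ such that $g_n\to f$ in $L^1(-T,T;X)$ and $v_n\to u$ uniformly on $[-T,T]$. \textbf{Theorem.} There are a complex number $\kappa\ne0$ and a circle $\Gamma$, depending only on $T$ and $U$, such that the closed disc bounded by $\Gamma$ does not meet $(-\infty,0]$, the spectrum of $U(t,s)+\kappa I$ lies inside $\Gamma$ for all $t,s\in[-T,T]$, and, with the bounded operators $$a(t,s):=\mathrm{Log}(U(t,s)+\kappa I)=\frac1{2\pi i}\int_\Gamma \mathrm{Log}\,\lambda\;(\lambda I-U(t,s)-\kappa I)^{-1}\,d\lambda$$ ($\mathrm{Log}$ the principal branch), the following holds. The series $\sum_{n\ge0}a(t,s)^n/n!$ converges absolutely in $B(X)$ for all $t,s\in[-T,T]$; and for every $f\in L^1(-T,T;X)$ that is locally H\"older continuous on $[-T,T]$ (each point of $[-T,T]$ has a neighbourhood in $[-T,T]$ on which $\|f(t)-f(r)\|\le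 C|t-r|^\gamma$ for some $C$ and some $0<\gamma\le1$), every $s\in[-T,T]$ and every $u_s\in X$, problem (1) has a unique solution $u\in C([-T,T];X)$, and for all $t\in[-T,T]$ $$u(t)=\Big[\sum_{n=0}^\infty\frac{a(t,s)^n}{n!}-\kappa I\Big]u_s+\int_s^t\Big[\sum_{n=0}^\infty\frac{a(t,\tau)^n}{n!}-\kappa I\Big]f(\tau)\,d\tau ,$$ the integrand being Bochner integrable between $s$ and $t$. -/

import Mathlib

open Set Filter Topology MeasureTheory
open scoped NNReal

/-- A two-parameter group of bounded operators on `X` over `[-T, T]`: the algebraic laws for all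
times in arbitrary order (so that `U s t` is the inverse of `U t s`), strong continuity of
`t ↦ U t s x` on `[s, T]`, and the exponential bound. -/
structure IsTwoParameterGroup {X : Type*} [NormedAddCommGroup X] [NormedSpace ℂ X]
    (T : ℝ) (U : ℝ → ℝ → X →L[ℂ] X) : Prop where
  comp : ∀ t ∈ Icc (-T) T, ∀ r ∈ Icc (-T) T, ∀ s ∈ Icc (-T) T, (U t r).comp (U r s) = U t s
  self : ∀ s ∈ Icc (-T) T, U s s = ContinuousLinearMap.id ℂ X
  continuousOn : ∀ s ∈ Icc (-T) T, ∀ x : X, ContinuousOn (fun t => U t s x) (Icc s T)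
  bound : ∃ M β : ℝ, ∀ t ∈ Icc (-T) T, ∀ s ∈ Icc (-T) T, ‖U t s‖ ≤ M * Real.exp (β * t)

/-- `A t : Y → X`, `t ∈ [-T, T]`, is the infinitesimal generator of `U` on the subspace `Y`:
`A t y = lim_{h → 0} h⁻¹ (U (t + h) t - I) y` for every `y ∈ Y`
(recall `U t t = I`; the limit is one-sided at the endpoints `± T`). -/
def IsInfinitesimalGenerator {X : Type*} [NormedAddCommGroup X] [NormedSpace ℂ X]
    (T : ℝ) (U : ℝ → ℝ → X →L[ℂ] X) (Y : Submodule ℂ X) (A : ℝ → Y →ₗ[ℂ] X) : Prop :=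
  ∀ t ∈ Icc (-T) T, ∀ y : Y,
    HasDerivWithinAt (fun r => U r t (y : X)) (A t y) (Icc (-T) T) t

/-- `f` is locally Hölder continuous on `S`: near each point of `S` it satisfies
`‖f t - f r‖ ≤ C |t - r| ^ γ` with some `C` and some `0 < γ ≤ 1`. -/
def IsLocallyHolderOn {X : Type*} [NormedAddCommGroup X] (f : ℝ → X) (S : Set ℝ) : Prop :=
  ∀ t₀ ∈ S, ∃ C γ : ℝ≥0, 0 < γ ∧ γ ≤ 1 ∧ ∃ V ∈ 𝓝[S] t₀, HolderOnWith C γ f V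

/-- `u` is a strict solution on `[-T, T]` of `u' = A(t) u + g`: at every time it lies in the
domain `Y`, is differentiable in `X`, and satisfies the equation. -/
structure IsStrictSolution {X : Type*} [NormedAddCommGroup X] [NormedSpace ℂ X]
    (T : ℝ) (Y : Submodule ℂ X) (A : ℝ → Y →ₗ[ℂ] X) (g : ℝ → X) (u : ℝ → X) : Prop where
  mem : ∀ t ∈ Icc (-T) T, u t ∈ Y
  hasDeriv : ∀ (t : ℝ) (ht : t ∈ Icc (-T) T),
    HasDerivWithinAt u (A t ⟨u t, mem t ht⟩ + g t) (Icc (-T) T) t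

/-- `u ∈ C([-T, T]; X)` is a (generalized) solution of the Cauchy problem
`u' = A(t) u + f`, `u s = x`, for `x ∈ X` and `f ∈ L¹(-T, T; X)`: it has the initial value `x`
and is the uniform limit on `[-T, T]` of strict solutions whose (continuous) inhomogeneous terms
converge to `f` in `L¹(-T, T; X)`. -/
structure IsSolution {X : Type*} [NormedAddCommGroup X] [NormedSpace ℂ X]
    (T : ℝ) (Y : Submodule ℂ X) (A : ℝ → Y →ₗ[ℂ] X) (f : ℝ → X) (s : ℝ) (x : X)
    (u : ℝ → X) : Prop where
  continuousOn : ContinuousOn u (Icc (-T) T)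
  init : u s = x
  approx : ∃ (g : ℕ → ℝ → X) (v : ℕ → ℝ → X),
    (∀ n, ContinuousOn (g n) (Icc (-T) T)) ∧
    (∀ n, IsStrictSolution T Y A (g n) (v n)) ∧
    Tendsto (fun n => ∫⁻ t in Ioo (-T) T, ‖g n t - f t‖ₑ) atTop (𝓝 0) ∧
    TendstoUniformlyOn v u atTop (Icc (-T) T)

/-- The Dunford-Riesz integral `(2πi)⁻¹ ∮_Γ Log z (z I - B)⁻¹ dz` of the principal logarithm,
over the circle `Γ` with centre `c` and radius `R`. -/
noncomputable def dunfordLog {X : Type*} [NormedAddCommGroup X] [NormedSpace ℂ X]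
    (c : ℂ) (R : ℝ) (B : X →L[ℂ] X) : X →L[ℂ] X :=
  (2 * (Real.pi : ℂ) * Complex.I)⁻¹ • ∮ z in C(c, R), Complex.log z • resolvent B z

/-- `a(t, s) = Log (U(t, s) + κ I)`, computed with the circle of centre `c` and radius `R`. -/
noncomputable def logEvolution {X : Type*} [NormedAddCommGroup X] [NormedSpace ℂ X]
    (U : ℝ → ℝ → X →L[ℂ] X) (κ c : ℂ) (R : ℝ) (t s : ℝ) : X →L[ℂ] X :=
  dunfordLog c R (U t s + κ • ContinuousLinearMap.id ℂ X)

/-- The `n`-th term `bⁿ / n!` of the exponential series of a bounded operator. -/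
noncomputable def expTerm {X : Type*} [NormedAddCommGroup X] [NormedSpace ℂ X]
    (b : X →L[ℂ] X) (n : ℕ) : X →L[ℂ] X :=
  ((n.factorial : ℂ)⁻¹) • b ^ n

/-!
Choose `K ≥ ‖U(t, s)‖` for all `t, s ∈ [-T, T]`, a real `κ > R > K`, and the circle with centre `κ`
and radius `R`. On this circle the resolvent of `U(t, s) + κ` is a geometric series in `U(t, s)`, so
the Dunford integral of `Log` is the Taylor series of `Log` at `κ` evaluated at `U(t, s)`, that is
`log κ + log (1 + κ⁻¹ U(t, s))`. Its exponential is `U(t, s) + κ` (`exp_dunfordLog`). Hence the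
representation formula is Duhamel's formula
`u(t) = U(t, s) x + ∫ₛᵗ U(t, τ) f(τ) dτ`.

A strict solution `v` satisfies Duhamel's formula since `d/dτ U(t, τ) v(τ) = U(t, τ) g(τ)`
(`IsStrictSolution.eq_duhamel`). The formula survives uniform limits of solutions with `L¹` limits of
inhomogeneous terms, so it holds for every solution (`IsSolution.eq_duhamel`), which gives uniqueness
and the representation at once.

For existence, local Hölder continuity enters only through continuity of `f`. The function
`U(t, s) (x + ∫ₛᵗ U(s, τ) f(τ) dτ)` is approximated by replacing `x` with an element of the dense
subspace `Y` and the continuous integrand with finite sums `∑ pᵢ(τ) yᵢ`, `yᵢ ∈ Y`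
(`exists_sum_smul_approx`). The result is a finite sum of terms `P(t) U(t, s) y` with `y ∈ Y`, hence
a strict solution, with inhomogeneous term uniformly close to `f`
(`exists_strictSolution_near`, `exists_isSolution`).
-/

/-! ### The exponential of the Dunford logarithm -/

section FunctionalCalculus

variable {𝔸 : Type*} [NormedRing 𝔸] [NormedAlgebra ℂ 𝔸] [CompleteSpace 𝔸]

/-- Chain rule for `exp ∘ L` in a noncommutative algebra, when `L z` commutes with all values of
`L`: write `exp (L w) = exp (L z) * exp (L w - L z)` and differentiate `exp` at `0`. -/
theorem hasDerivAt_exp_comp_of_commute {L : ℂ → 𝔸} {L' : 𝔸} {z : ℂ}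
    (hL : HasDerivAt L L' z) (hcomm : ∀ w, Commute (L z) (L w)) :
    HasDerivAt (fun w => NormedSpace.exp (L w)) (NormedSpace.exp (L z) * L') z := by
  have h0 : HasFDerivAt (NormedSpace.exp : 𝔸 → 𝔸) (1 : 𝔸 →L[ℂ] 𝔸) (L z - L z) := by
    rw [sub_self]; exact hasFDerivAt_exp_zero
  have h1 : HasDerivAt (fun w => NormedSpace.exp (L w - L z)) L' z := by
    exact h0.comp_hasDerivAt z (hL.sub_const (L z))
  have h2 := h1.const_mul (NormedSpace.exp (L z))
  refine h2.congr_of_eventuallyEq (Eventually.of_forall fun w => ?_)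
  let : NormedAlgebra ℚ 𝔸 := NormedAlgebra.restrictScalars ℚ ℂ 𝔸
  have hc : Commute (L z) (L w - L z) := (hcomm w).sub_right (Commute.refl _)
  show NormedSpace.exp (L w) = NormedSpace.exp (L z) * NormedSpace.exp (L w - L z)
  rw [← NormedSpace.exp_add_of_commute hc, add_sub_cancel]

/-- `exp (log (1 + a)) = 1 + a` for `‖a‖ < 1`, with the logarithm given by its power series:
`exp (-log (1 + z a)) (1 + z a)` has derivative zero in `z`, so its values at `0` and `1` agree. -/
theorem exp_tsum_log_one_add {a : 𝔸} (ha : ‖a‖ < 1) :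
    NormedSpace.exp (∑' n : ℕ, ((-1 : ℂ) ^ n / (n + 1)) • a ^ (n + 1)) = 1 + a := by
  -- a disc of radius `ρ > 1` contains both `0` and `1` in its interior
  obtain ⟨ρ, hρ1, hρa⟩ : ∃ ρ : ℝ, 1 < ρ ∧ ρ * ‖a‖ < 1 := by
    have : Tendsto (fun ρ : ℝ => ρ * ‖a‖) (𝓝[>] 1) (𝓝 (1 * ‖a‖)) :=
      ((continuous_id.mul continuous_const).tendsto 1).mono_left nhdsWithin_le_nhds
    have h := (this.eventually (gt_mem_nhds (by simpa using ha))).and self_mem_nhdsWithin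
    obtain ⟨ρ, h1, h2⟩ := h.exists
    exact ⟨ρ, h2, h1⟩
  have hρ0 : 0 < ρ := by linarith
  have hlt : ∀ z ∈ Metric.ball (0 : ℂ) ρ, ‖z • a‖ < 1 := fun z hz => by
    rw [norm_smul]
    refine lt_of_le_of_lt ?_ hρa
    gcongr
    exact (mem_ball_zero_iff.mp hz).le
  set L : ℂ → 𝔸 := fun z =>
    ∑' n : ℕ, ((-1 : ℂ) ^ n / (n + 1) * z ^ (n + 1)) • a ^ (n + 1) with hLdef
  -- the derivative of the logarithmic series is the geometric series `a * (1 + z a)⁻¹`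
  have hL : ∀ z ∈ Metric.ball (0 : ℂ) ρ,
      HasDerivAt L (∑' n : ℕ, ((-1 : ℂ) ^ n * z ^ n) • a ^ (n + 1)) z := by
    intro z hz
    refine hasDerivAt_tsum_of_isPreconnected (F := 𝔸)
      (g := fun (n : ℕ) (z : ℂ) => ((-1 : ℂ) ^ n / (n + 1) * z ^ (n + 1)) • a ^ (n + 1))
      (g' := fun (n : ℕ) (z : ℂ) => ((-1 : ℂ) ^ n * z ^ n) • a ^ (n + 1))
      (u := fun n => (ρ * ‖a‖) ^ n * ‖a‖)
      ((summable_geometric_of_lt_one (by positivity) hρa).mul_right _) Metric.isOpen_ball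
      (convex_ball (0 : ℂ) ρ).isPreconnected (fun n y _ => ?_) (fun n y hy => ?_)
      (Metric.mem_ball_self hρ0) ?_ hz
    · have h := ((hasDerivAt_pow (n + 1) y).const_mul ((-1 : ℂ) ^ n / (n + 1))).smul_const
        (a ^ (n + 1))
      convert h using 2
      have : (n : ℂ) + 1 ≠ 0 := by exact_mod_cast Nat.succ_ne_zero n
      push_cast
      field_simp
    · rw [norm_smul, norm_mul, norm_pow, norm_pow, norm_neg, norm_one, one_pow, one_mul]
      have h1 : ‖a ^ (n + 1)‖ ≤ ‖a‖ ^ (n + 1) := norm_pow_le' a n.succ_pos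
      have h2 : ‖y‖ ≤ ρ := (mem_ball_zero_iff.mp hy).le
      calc ‖y‖ ^ n * ‖a ^ (n + 1)‖ ≤ ρ ^ n * ‖a‖ ^ (n + 1) := by gcongr
        _ = (ρ * ‖a‖) ^ n * ‖a‖ := by ring
    · simp
  have hL' : ∀ z ∈ Metric.ball (0 : ℂ) ρ,
      (∑' n : ℕ, ((-1 : ℂ) ^ n * z ^ n) • a ^ (n + 1)) * (1 + z • a) = a := by
    intro z hz
    have h1 : ∀ n : ℕ, ((-1 : ℂ) ^ n * z ^ n) • a ^ (n + 1) = a * (-(z • a)) ^ n := fun n => by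
      rw [← neg_smul, smul_pow, mul_smul_comm, ← pow_succ', ← mul_pow, neg_one_mul]
    have hn : ‖-(z • a)‖ < 1 := by rw [norm_neg]; exact hlt z hz
    simp_rw [h1]
    rw [(summable_geometric_of_norm_lt_one hn).tsum_mul_left, mul_assoc]
    have := geom_series_mul_neg (-(z • a)) hn
    rw [sub_neg_eq_add] at this
    rw [this, mul_one]
  have hcomm : ∀ z w, Commute (L z) (L w) := fun z w => by
    have hc : ∀ b, Commute b a → Commute b (L w) := fun b hb =>
      Commute.tsum_right _ fun n => (hb.pow_right _).smul_right _
    refine hc _ (Commute.tsum_left _ fun n => ((Commute.refl a).pow_left _).smul_left _)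
  have hexp : ∀ z ∈ Metric.ball (0 : ℂ) ρ,
      HasDerivAt (fun w => NormedSpace.exp (-L w) * (1 + w • a)) 0 z := by
    intro z hz
    have h1 := hasDerivAt_exp_comp_of_commute (L := fun w => -L w) (hL z hz).neg
      (fun w => ((hcomm z w).neg_left).neg_right)
    have h2 : HasDerivAt (fun w : ℂ => 1 + w • a) a z := by
      simpa using ((hasDerivAt_id z).smul_const a).const_add 1
    refine (h1.mul h2).congr_deriv ?_
    rw [mul_assoc, neg_mul, hL' z hz]
    simp
  have hconst := Metric.isOpen_ball.is_const_of_deriv_eq_zero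
    (convex_ball (0 : ℂ) ρ).isPreconnected
    (fun z hz => (hexp z hz).differentiableAt.differentiableWithinAt)
    (fun z hz => (hexp z hz).deriv)
    (x := 1) (y := 0) (by simpa using hρ1) (Metric.mem_ball_self hρ0)
  have hL0 : L 0 = 0 := by simp [hLdef]
  simp only [hL0, neg_zero, NormedSpace.exp_zero, one_smul, zero_smul, add_zero, mul_one] at hconst
  have hL1 : L 1 = ∑' n : ℕ, ((-1 : ℂ) ^ n / (n + 1)) • a ^ (n + 1) := by simp [hLdef]
  let : NormedAlgebra ℚ 𝔸 := NormedAlgebra.restrictScalars ℚ ℂ 𝔸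
  have hinv : NormedSpace.exp (L 1) * NormedSpace.exp (-L 1) = 1 := by
    rw [← NormedSpace.exp_add_of_commute ((Commute.refl (L 1)).neg_right), add_neg_cancel,
      NormedSpace.exp_zero]
  calc NormedSpace.exp (∑' n : ℕ, ((-1 : ℂ) ^ n / (n + 1)) • a ^ (n + 1))
      = NormedSpace.exp (L 1) * (NormedSpace.exp (-L 1) * (1 + a)) := by rw [hconst, hL1, mul_one]
    _ = 1 + a := by rw [← mul_assoc, hinv, one_mul]

theorem hasSum_resolvent_add_algebraMap {a : 𝔸} {c z : ℂ} (hz : ‖a‖ < ‖z - c‖) :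
    HasSum (fun n : ℕ => ((z - c)⁻¹ ^ n * (z - c)⁻¹) • a ^ n)
      (resolvent (a + algebraMap ℂ 𝔸 c) z) := by
  have h0 : z - c ≠ 0 := norm_pos_iff.mp ((norm_nonneg a).trans_lt hz)
  have hlt : ‖(z - c)⁻¹ • a‖ < 1 := by
    rw [norm_smul, norm_inv, inv_mul_lt_iff₀ (norm_pos_iff.mpr h0), mul_one]; exact hz
  have hu : algebraMap ℂ 𝔸 z - (a + algebraMap ℂ 𝔸 c)
      = (Units.mk0 (z - c) h0) • (1 - (z - c)⁻¹ • a) := by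
    rw [Units.smul_mk0, smul_sub, smul_inv_smul₀ h0, Algebra.algebraMap_eq_smul_one,
      Algebra.algebraMap_eq_smul_one, sub_smul]
    abel
  have h := (hasSum_geom_series_inverse _ hlt).const_smul (z - c)⁻¹
  have hr : resolvent (a + algebraMap ℂ 𝔸 c) z = (z - c)⁻¹ • Ring.inverse (1 - (z - c)⁻¹ • a) := by
    have hunit : IsUnit (1 - (z - c)⁻¹ • a) := isUnit_one_sub_of_norm_lt_one hlt
    obtain ⟨v, hv⟩ := hunit
    have h1 : Ring.inverse (((Units.mk0 (z - c) h0) • v : 𝔸ˣ) : 𝔸)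
       = ((((Units.mk0 (z - c) h0) • v)⁻¹ : 𝔸ˣ) : 𝔸) := Ring.inverse_unit _
    rw [resolvent, hu, ← hv, ← Units.val_smul, h1, Ring.inverse_unit]
    simp [Units.smul_def]
  rw [hr]
  convert h using 2 with n
  rw [smul_pow, smul_smul, mul_comm]

/-- The Dunford integral over the circle with centre `c` and radius `R > ‖a‖`, at the element
`a + c`, is the power series in `a` whose coefficients are the Cauchy integrals of `f`. -/
theorem hasSum_circleIntegral_smul_resolvent {f : ℂ → ℂ} {c : ℂ} {R : ℝ} {a : 𝔸}
    (hf : CircleIntegrable f c R) (ha : ‖a‖ < R) :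
    HasSum (fun n : ℕ => (∮ z in C(c, R), (z - c)⁻¹ ^ n • (z - c)⁻¹ • f z) • a ^ n)
      (∮ z in C(c, R), f z • resolvent (a + algebraMap ℂ 𝔸 c) z) := by
  have hR : 0 < R := (norm_nonneg a).trans_lt ha
  have hq : ‖a‖ / R < 1 := (div_lt_one hR).2 ha
  have key : HasSum (fun n : ℕ => ∮ z in C(c, R), ((z - c)⁻¹ ^ n • (z - c)⁻¹ • f z) • a ^ n)
      (∮ z in C(c, R), f z • resolvent (a + algebraMap ℂ 𝔸 c) z) := by
    refine intervalIntegral.hasSum_integral_of_dominated_convergence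
      (fun n θ => ‖f (circleMap c R θ)‖ * (‖(1 : 𝔸)‖ + 1) * (‖a‖ / R) ^ n)
      (fun n => ?_) (fun n => ?_) ?_ ?_ ?_
    · simp only [deriv_circleMap]
      refine AEStronglyMeasurable.smul ?_ (AEStronglyMeasurable.smul ?_ aestronglyMeasurable_const)
      · exact Measurable.aestronglyMeasurable (by fun_prop)
      · have h1 : Measurable fun θ => (circleMap c R θ - c)⁻¹ := by fun_prop
        exact (h1.pow_const n).aestronglyMeasurable.smul (h1.aestronglyMeasurable.smul hf.def'.1)
    · refine Eventually.of_forall fun θ _ => ?_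
      -- the factor `‖1‖ + 1` covers `n = 0`, as `‖1‖` need not be `1`
      have h1 : ‖a ^ n‖ ≤ (‖(1 : 𝔸)‖ + 1) * ‖a‖ ^ n := by
        rcases Nat.eq_zero_or_pos n with rfl | hn
        · simp
        · exact (norm_pow_le' a hn).trans (le_mul_of_one_le_left (by positivity)
            (by linarith [norm_nonneg (1 : 𝔸)]))
      simp only [norm_smul, deriv_circleMap, norm_mul, norm_pow, norm_inv, circleMap_sub_center,
        norm_circleMap_zero, Complex.norm_I, abs_of_pos hR, mul_one]
      calc R * (R⁻¹ ^ n * (R⁻¹ * ‖f (circleMap c R θ)‖) * ‖a ^ n‖)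
          ≤ R * (R⁻¹ ^ n * (R⁻¹ * ‖f (circleMap c R θ)‖) * ((‖(1 : 𝔸)‖ + 1) * ‖a‖ ^ n)) := by
            gcongr
        _ = _ := by rw [div_eq_mul_inv, mul_pow]; field_simp
    · exact Eventually.of_forall fun _ _ =>
        (summable_geometric_of_lt_one (by positivity) hq).mul_left _
    · simp_rw [tsum_mul_left, tsum_geometric_of_lt_one (show 0 ≤ ‖a‖ / R by positivity) hq]
      exact (hf.norm.mul_const _).mul_const _
    · refine Eventually.of_forall fun θ _ => HasSum.const_smul _ ?_
      have hz : ‖a‖ < ‖circleMap c R θ - c‖ := by simpa [abs_of_pos hR] using ha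
      refine ((hasSum_resolvent_add_algebraMap hz).const_smul (f (circleMap c R θ))).congr_fun ?_
      intro n
      simp only [smul_smul, smul_eq_mul]
      congr 1; ring
  convert key using 2 with n
  rw [circleIntegral.integral_smul_const]

/-- The Taylor coefficients of the logarithm at `κ > 0`, as Cauchy integrals, identified by
uniqueness of power series expansions. -/
theorem circleIntegral_log_coeff {κ R : ℝ} (hR : 0 < R) (hκ : R < κ) (n : ℕ) :
    (2 * (Real.pi : ℂ) * Complex.I)⁻¹ •
        ∮ z in C((κ : ℂ), R), (z - κ)⁻¹ ^ n • (z - κ)⁻¹ • Complex.log z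
      = if n = 0 then Complex.log κ else (-1) ^ (n + 1) * (κ : ℂ)⁻¹ ^ n / n := by
  lift R to ℝ≥0 using hR.le
  have hκ0 : 0 < κ := hR.trans hκ
  have hκne : (κ : ℂ) ≠ 0 := by exact_mod_cast hκ0.ne'
  have hd : DifferentiableOn ℂ Complex.log (Metric.closedBall (κ : ℂ) R) := fun z hz => by
    refine (Complex.differentiableAt_log ?_).differentiableWithinAt
    left
    have h1 := (Complex.abs_re_le_norm (z - κ)).trans (mem_closedBall_iff_norm.mp hz)
    have h2 := (abs_le.mp h1).1
    simp at h2
    linarith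
  have h1 := (hd.hasFPowerSeriesOnBall (by exact_mod_cast hR)).hasFPowerSeriesAt
  set p : FormalMultilinearSeries ℂ ℂ ℂ := fun n => ContinuousMultilinearMap.mkPiRing ℂ _
    (if n = 0 then Complex.log κ else (-1) ^ (n + 1) * (κ : ℂ)⁻¹ ^ n / n : ℂ) with hp
  have h2 : HasFPowerSeriesAt Complex.log p κ := by
    rw [hasFPowerSeriesAt_iff]
    filter_upwards [Metric.ball_mem_nhds (0 : ℂ) hκ0] with w hw
    have hw' : ‖w / κ‖ < 1 := by
      rw [norm_div, Complex.norm_real, Real.norm_of_nonneg hκ0.le, div_lt_one hκ0]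
      simpa using hw
    have hlog : Complex.log (κ + w) = Complex.log κ + Complex.log (1 + w / κ) := by
      have hne : 1 + w / κ ≠ 0 := fun h => by
        rw [eq_neg_of_add_eq_zero_right h, norm_neg, norm_one] at hw'
        exact lt_irrefl _ hw'
      rw [← Complex.ofReal_log hκ0.le, ← Complex.log_ofReal_mul hκ0 hne, mul_add, mul_one,
        mul_div_cancel₀ _ hκne]
    have hs := (hasSum_ite_eq (0 : ℕ) (Complex.log κ)).add (Complex.hasSum_taylorSeries_log hw')
    rw [hlog]
    refine hs.congr_fun fun n => ?_
    simp only [FormalMultilinearSeries.coeff, hp]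
    rcases eq_or_ne n 0 with rfl | hn
    · simp
    · simp [hn, div_eq_mul_inv]; ring
  have h3 := congrArg (fun q : FormalMultilinearSeries ℂ ℂ ℂ => q n fun _ => 1)
    (h1.eq_formalMultilinearSeries h2)
  simpa [cauchyPowerSeries, hp] using h3

end FunctionalCalculus

section DunfordLog

variable {X : Type*} [NormedAddCommGroup X] [NormedSpace ℂ X] [CompleteSpace X]

/-- The Dunford logarithm is a logarithm: over a circle centred at `κ` it equals
`log κ + log (1 + κ⁻¹ a)`, whose exponential is `κ + a`. -/
theorem exp_dunfordLog {κ R : ℝ} (hκ : R < κ) {a : X →L[ℂ] X} (ha : ‖a‖ < R) :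
    NormedSpace.exp (dunfordLog κ R (a + (κ : ℂ) • ContinuousLinearMap.id ℂ X))
      = a + (κ : ℂ) • ContinuousLinearMap.id ℂ X := by
  have hR : 0 < R := (norm_nonneg a).trans_lt ha
  have hκ0 : 0 < κ := hR.trans hκ
  have hκne : (κ : ℂ) ≠ 0 := by exact_mod_cast hκ0.ne'
  have hint : CircleIntegrable Complex.log (κ : ℂ) R := by
    refine ContinuousOn.circleIntegrable hR.le fun z hz => ?_
    refine (continuousAt_clog (Or.inl ?_)).continuousWithinAt
    have h1 := (Complex.abs_re_le_norm (z - κ)).trans (mem_sphere_iff_norm.mp hz).le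
    have h2 := (abs_le.mp h1).1
    simp at h2
    linarith
  have hid : (κ : ℂ) • ContinuousLinearMap.id ℂ X = algebraMap ℂ (X →L[ℂ] X) κ := by
    rw [Algebra.algebraMap_eq_smul_one]; rfl
  rw [hid]
  have hs : HasSum (fun n : ℕ =>
      (if n = 0 then Complex.log κ else (-1) ^ (n + 1) * (κ : ℂ)⁻¹ ^ n / n) • a ^ n)
      (dunfordLog κ R (a + algebraMap ℂ (X →L[ℂ] X) κ)) := by
    refine ((hasSum_circleIntegral_smul_resolvent hint ha).const_smul
      (2 * (Real.pi : ℂ) * Complex.I)⁻¹).congr_fun fun n => ?_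
    rw [← circleIntegral_log_coeff hR hκ, smul_assoc]
  have hb : ‖(κ : ℂ)⁻¹ • a‖ < 1 := by
    rw [norm_smul, norm_inv, Complex.norm_real, Real.norm_of_nonneg hκ0.le,
      inv_mul_lt_iff₀ hκ0, mul_one]
    exact ha.trans hκ
  have heq : dunfordLog κ R (a + algebraMap ℂ (X →L[ℂ] X) κ)
      = algebraMap ℂ (X →L[ℂ] X) (Complex.log κ)
        + ∑' n : ℕ, ((-1 : ℂ) ^ n / (n + 1)) • ((κ : ℂ)⁻¹ • a) ^ (n + 1) := by
    rw [← hs.tsum_eq, hs.summable.tsum_eq_zero_add]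
    congr 1
    refine tsum_congr fun n => ?_
    rw [if_neg n.succ_ne_zero, smul_pow, smul_smul]
    congr 1
    push_cast
    ring
  let : NormedAlgebra ℚ (X →L[ℂ] X) := NormedAlgebra.restrictScalars ℚ ℂ _
  rw [heq, NormedSpace.exp_add_of_commute (Algebra.commutes _ _), exp_tsum_log_one_add hb,
    ← NormedSpace.algebraMap_exp_comm, ← Complex.exp_eq_exp_ℂ, Complex.exp_log hκne,
    Algebra.algebraMap_eq_smul_one, smul_one_mul, smul_add, smul_inv_smul₀ hκne, add_comm]

end DunfordLog

/-! ### Two-parameter groups and Duhamel's formula -/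

section Evolution

variable {X : Type*} [NormedAddCommGroup X] [NormedSpace ℂ X]

/-- A strongly continuous, uniformly bounded family of operators applied to a continuous function
gives a continuous function. -/
theorem ContinuousOn.clm_apply_of_bounded {α : Type*} [TopologicalSpace α] {S : Set α}
    {W : α → X →L[ℂ] X} {K : ℝ} (hK : ∀ t ∈ S, ‖W t‖ ≤ K)
    (hW : ∀ x, ContinuousOn (fun t => W t x) S) {g : α → X} (hg : ContinuousOn g S) :
    ContinuousOn (fun t => W t (g t)) S := by
  intro t ht
  have h1 : Tendsto (fun r => K * ‖g r - g t‖) (𝓝[S] t) (𝓝 0) := by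
    have := ((hg t ht).sub_const (g t)).norm.const_mul K
    simpa [ContinuousWithinAt] using this
  have h2 : Tendsto (fun r => W r (g r - g t)) (𝓝[S] t) (𝓝 0) := by
    refine squeeze_zero_norm' ?_ h1
    filter_upwards [self_mem_nhdsWithin] with r hr
    exact (W r).le_of_opNorm_le (hK r hr) _
  have h3 := h2.add (hW (g t) t ht)
  rw [zero_add] at h3
  exact h3.congr fun r => by simp

variable {T : ℝ} {U : ℝ → ℝ → X →L[ℂ] X}

namespace IsTwoParameterGroup

theorem apply_apply (hU : IsTwoParameterGroup T U) {t r s : ℝ} (ht : t ∈ Icc (-T) T)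
    (hr : r ∈ Icc (-T) T) (hs : s ∈ Icc (-T) T) (x : X) : U t r (U r s x) = U t s x := by
  rw [← hU.comp t ht r hr s hs]; rfl

theorem self_apply (hU : IsTwoParameterGroup T U) {s : ℝ} (hs : s ∈ Icc (-T) T) (x : X) :
    U s s x = x := by
  rw [hU.self s hs]; rfl

theorem exists_norm_le (hU : IsTwoParameterGroup T U) :
    ∃ K : ℝ, 0 ≤ K ∧ ∀ t ∈ Icc (-T) T, ∀ s ∈ Icc (-T) T, ‖U t s‖ ≤ K := by
  obtain ⟨M, β, h⟩ := hU.bound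
  refine ⟨|M| * Real.exp (|β| * T), by positivity, fun t ht s hs => (h t ht s hs).trans ?_⟩
  have hβ : β * t ≤ |β| * T := by
    refine (le_abs_self _).trans ?_
    rw [abs_mul]
    gcongr
    exact abs_le.mpr ht
  gcongr
  exact le_abs_self M

/-- Strong continuity in the first variable on all of `[-T, T]`, not only to the right of `s`:
factor through the time `-T`. -/
theorem continuousOn_left (hU : IsTwoParameterGroup T U) {s : ℝ} (hs : s ∈ Icc (-T) T) (x : X) :
    ContinuousOn (fun t => U t s x) (Icc (-T) T) := by
  have h0 : -T ∈ Icc (-T) T := left_mem_Icc.mpr (hs.1.trans hs.2)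
  exact (hU.continuousOn (-T) h0 (U (-T) s x)).congr fun t ht => (hU.apply_apply ht h0 hs x).symm

/-- Strong continuity in the second variable, from
`U(t, r) x - U(t, τ) x = U(t, r) (x - U(r, τ) x)` and the uniform bound. -/
theorem continuousOn_right (hU : IsTwoParameterGroup T U) {t : ℝ} (ht : t ∈ Icc (-T) T) (x : X) :
    ContinuousOn (fun τ => U t τ x) (Icc (-T) T) := by
  obtain ⟨K, -, hK⟩ := hU.exists_norm_le
  intro τ hτ
  have h1 : Tendsto (fun r => K * ‖x - U r τ x‖) (𝓝[Icc (-T) T] τ) (𝓝 0) := by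
    have := ((hU.continuousOn_left hτ x τ hτ).const_sub x).norm.const_mul K
    simpa [ContinuousWithinAt, hU.self_apply hτ] using this
  have h2 : Tendsto (fun r => U t r x - U t τ x) (𝓝[Icc (-T) T] τ) (𝓝 0) := by
    refine squeeze_zero_norm' ?_ h1
    filter_upwards [self_mem_nhdsWithin] with r hr
    rw [← hU.apply_apply ht hr hτ, ← map_sub]
    exact (U t r).le_of_opNorm_le (hK t ht r hr) _
  exact tendsto_sub_nhds_zero_iff.mp h2

theorem continuousOn_left_apply (hU : IsTwoParameterGroup T U) {s : ℝ} (hs : s ∈ Icc (-T) T)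
    {g : ℝ → X} (hg : ContinuousOn g (Icc (-T) T)) :
    ContinuousOn (fun t => U t s (g t)) (Icc (-T) T) := by
  obtain ⟨K, -, hK⟩ := hU.exists_norm_le
  exact hg.clm_apply_of_bounded (fun t ht => hK t ht s hs) (hU.continuousOn_left hs)

theorem continuousOn_right_apply (hU : IsTwoParameterGroup T U) {t : ℝ} (ht : t ∈ Icc (-T) T)
    {g : ℝ → X} (hg : ContinuousOn g (Icc (-T) T)) :
    ContinuousOn (fun τ => U t τ (g τ)) (Icc (-T) T) := by
  obtain ⟨K, -, hK⟩ := hU.exists_norm_le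
  exact hg.clm_apply_of_bounded (fun τ hτ => hK t ht τ hτ) (hU.continuousOn_right ht)

end IsTwoParameterGroup

variable {Y : Submodule ℂ X} {A : ℝ → Y →ₗ[ℂ] X}

/-- Along a strict solution `v` the generator cancels: `d/dτ U(t, τ) v(τ) = U(t, τ) g(τ)`. -/
theorem IsStrictSolution.hasDerivWithinAt_evolution_apply (hU : IsTwoParameterGroup T U)
    (hA : IsInfinitesimalGenerator T U Y A) {g v : ℝ → X} (hv : IsStrictSolution T Y A g v)
    {t τ : ℝ} (ht : t ∈ Icc (-T) T) (hτ : τ ∈ Icc (-T) T) :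
    HasDerivWithinAt (fun r => U t r (v r)) (U t τ (g τ)) (Icc (-T) T) τ := by
  obtain ⟨K, -, hK⟩ := hU.exists_norm_le
  set S := Icc (-T) T with hS
  have h1 : HasDerivWithinAt (fun r => v r - U r τ (v τ)) (g τ) S τ := by
    exact ((hv.hasDeriv τ hτ).sub (hA τ hτ ⟨v τ, hv.mem τ hτ⟩)).congr_deriv
      (add_sub_cancel_left _ _)
  rw [hasDerivWithinAt_iff_tendsto_slope] at h1 ⊢
  set q := slope (fun r => v r - U r τ (v τ)) τ with hq
  -- the difference quotient is `U t r` applied to the quotient of `v r - U r τ (v τ)`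
  have hslope : ∀ r ∈ S, slope (fun r => U t r (v r)) τ r = U t r (q r) := fun r hr => by
    simp only [hq, slope_def_module, hU.self_apply hτ, sub_self, sub_zero]
    rw [(U t r).map_smul_of_tower, map_sub, hU.apply_apply ht hr hτ]
  have h2 : Tendsto (fun r => K * ‖q r - g τ‖) (𝓝[S \ {τ}] τ) (𝓝 0) := by
    simpa using (h1.sub_const (g τ)).norm.const_mul K
  have h3 : Tendsto (fun r => U t r (q r - g τ)) (𝓝[S \ {τ}] τ) (𝓝 0) := by
    refine squeeze_zero_norm' ?_ h2
    filter_upwards [self_mem_nhdsWithin] with r hr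
    exact (U t r).le_of_opNorm_le (hK t ht r hr.1) _
  have h4 := h3.add ((hU.continuousOn_right ht (g τ) τ hτ).mono_left
    (nhdsWithin_mono τ sdiff_subset))
  rw [zero_add] at h4
  refine h4.congr' ?_
  filter_upwards [self_mem_nhdsWithin] with r hr
  rw [hslope r hr.1, map_sub, sub_add_cancel]

/-- Duhamel's formula for strict solutions. -/
theorem IsStrictSolution.eq_duhamel [CompleteSpace X] (hU : IsTwoParameterGroup T U)
    (hA : IsInfinitesimalGenerator T U Y A) {g v : ℝ → X} (hg : ContinuousOn g (Icc (-T) T))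
    (hv : IsStrictSolution T Y A g v) {t s : ℝ} (ht : t ∈ Icc (-T) T) (hs : s ∈ Icc (-T) T) :
    v t = U t s (v s) + ∫ τ in s..t, U t τ (g τ) := by
  have hsub : uIcc s t ⊆ Icc (-T) T := uIcc_subset_Icc hs ht
  have hd := fun τ hτ => hv.hasDerivWithinAt_evolution_apply hU hA (t := t) (τ := τ) ht hτ
  have h := intervalIntegral.integral_eq_sub_of_hasDeriv_right
    (f := fun r => U t r (v r)) (f' := fun τ => U t τ (g τ)) (a := s) (b := t)
    (fun τ hτ => ((hd τ (hsub hτ)).continuousWithinAt).mono hsub)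
    (fun τ hτ => ((hd τ (hsub (Ioo_subset_Icc_self hτ))).hasDerivAt
      (Icc_mem_nhds ((le_min hs.1 ht.1).trans_lt hτ.1)
        (hτ.2.trans_le (max_le hs.2 ht.2)))).hasDerivWithinAt)
    ((hU.continuousOn_right_apply ht hg).mono hsub).intervalIntegrable
  rw [h, hU.self_apply ht]
  abel

end Evolution

/-! ### Limits of strict solutions -/

theorem IsLocallyHolderOn.continuousOn {X : Type*} [NormedAddCommGroup X] {f : ℝ → X} {S : Set ℝ}
    (hf : IsLocallyHolderOn f S) : ContinuousOn f S := by
  intro t ht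
  obtain ⟨C, γ, hγ, -, V, hV, hH⟩ := hf t ht
  exact ((hH.continuousOn hγ t (mem_of_mem_nhdsWithin ht hV)).mono_of_mem_nhdsWithin hV)

section GeneralizedSolutions

variable {X : Type*} [NormedAddCommGroup X] [NormedSpace ℂ X]
variable {T : ℝ} {U : ℝ → ℝ → X →L[ℂ] X}
variable {Y : Submodule ℂ X} {A : ℝ → Y →ₗ[ℂ] X}

/-- `L¹` convergence of the inhomogeneous terms passes to the Duhamel integrals, because the
operators `U t τ` are uniformly bounded. -/
theorem tendsto_intervalIntegral_evolution (hU : IsTwoParameterGroup T U) {f : ℝ → X}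
    {g : ℕ → ℝ → X} (hf : ContinuousOn f (Icc (-T) T)) (hg : ∀ n, ContinuousOn (g n) (Icc (-T) T))
    (hlim : Tendsto (fun n => ∫⁻ t in Ioo (-T) T, ‖g n t - f t‖ₑ) atTop (𝓝 0))
    {t s : ℝ} (ht : t ∈ Icc (-T) T) (hs : s ∈ Icc (-T) T) :
    Tendsto (fun n => ∫ τ in s..t, U t τ (g n τ)) atTop (𝓝 (∫ τ in s..t, U t τ (f τ))) := by
  obtain ⟨K, hK0, hK⟩ := hU.exists_norm_le
  have hsub : uIcc s t ⊆ Icc (-T) T := uIcc_subset_Icc hs ht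
  have hsub' : uIoc s t ⊆ Icc (-T) T := uIoc_subset_uIcc.trans hsub
  have hint : ∀ {h : ℝ → X}, ContinuousOn h (Icc (-T) T) →
      IntervalIntegrable (fun τ => U t τ (h τ)) volume s t := fun hh =>
    ((hU.continuousOn_right_apply ht hh).mono hsub).intervalIntegrable
  rw [tendsto_iff_edist_tendsto_0]
  have hlim' : Tendsto (fun n => ENNReal.ofReal K * ∫⁻ t in Ioo (-T) T, ‖g n t - f t‖ₑ)
      atTop (𝓝 0) := by
    simpa using ENNReal.Tendsto.const_mul hlim (Or.inr ENNReal.ofReal_ne_top)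
  refine tendsto_of_tendsto_of_tendsto_of_le_of_le tendsto_const_nhds hlim' (fun _ => zero_le)
    fun n => ?_
  show edist _ _ ≤ _
  rw [edist_eq_enorm_sub, ← intervalIntegral.integral_sub (hint (hg n)) (hint hf),
    ← ofReal_norm, intervalIntegral.norm_intervalIntegral_eq, ofReal_norm,
    ← lintegral_const_mul' _ _ ENNReal.ofReal_ne_top]
  refine (enorm_integral_le_lintegral_enorm _).trans ?_
  rw [setLIntegral_congr (Ioo_ae_eq_Icc (a := -T) (b := T) (μ := volume))]
  refine (setLIntegral_mono_ae' measurableSet_uIoc (Eventually.of_forall fun τ hτ => ?_)).trans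
    (lintegral_mono_set hsub')
  rw [← map_sub, ← ofReal_norm, ← ofReal_norm, ← ENNReal.ofReal_mul hK0]
  exact ENNReal.ofReal_le_ofReal ((U t τ).le_of_opNorm_le (hK t ht τ (hsub' hτ)) _)

/-- Every solution is given by Duhamel's formula; in particular it is determined by its data. -/
theorem IsSolution.eq_duhamel [CompleteSpace X] (hU : IsTwoParameterGroup T U)
    (hA : IsInfinitesimalGenerator T U Y A) {f u : ℝ → X} (hf : ContinuousOn f (Icc (-T) T))
    {t s : ℝ} {x : X} (hu : IsSolution T Y A f s x u) (ht : t ∈ Icc (-T) T)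
    (hs : s ∈ Icc (-T) T) :
    u t = U t s x + ∫ τ in s..t, U t τ (f τ) := by
  obtain ⟨g, v, hg, hv, hgf, hvu⟩ := hu.approx
  have h1 : Tendsto (fun n => U t s (v n s) + ∫ τ in s..t, U t τ (g n τ)) atTop
      (𝓝 (U t s x + ∫ τ in s..t, U t τ (f τ))) := by
    refine Tendsto.add ?_ (tendsto_intervalIntegral_evolution hU hf hg hgf ht hs)
    rw [← hu.init]
    exact ((U t s).continuous.tendsto _).comp (hvu.tendsto_at hs)
  refine tendsto_nhds_unique (hvu.tendsto_at ht) (h1.congr fun n => ?_)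
  exact ((hv n).eq_duhamel hU hA (hg n) ht hs).symm

/-! ### Construction of solutions -/

theorem IsStrictSolution.zero : IsStrictSolution T Y A (fun _ => 0) (fun _ => 0) where
  mem t ht := Y.zero_mem
  hasDeriv t ht := by
    have : (⟨0, Y.zero_mem⟩ : Y) = 0 := rfl
    simp only [this, map_zero, add_zero]
    exact hasDerivWithinAt_const _ _ _

theorem IsStrictSolution.add {g₁ g₂ v₁ v₂ : ℝ → X} (h₁ : IsStrictSolution T Y A g₁ v₁)
    (h₂ : IsStrictSolution T Y A g₂ v₂) :
    IsStrictSolution T Y A (fun t => g₁ t + g₂ t) (fun t => v₁ t + v₂ t) where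
  mem t ht := Y.add_mem (h₁.mem t ht) (h₂.mem t ht)
  hasDeriv t ht := by
    refine ((h₁.hasDeriv t ht).add (h₂.hasDeriv t ht)).congr_deriv ?_
    have : (⟨v₁ t + v₂ t, Y.add_mem (h₁.mem t ht) (h₂.mem t ht)⟩ : Y)
      = ⟨v₁ t, h₁.mem t ht⟩ + ⟨v₂ t, h₂.mem t ht⟩ := rfl
    rw [this, map_add]
    abel

theorem IsStrictSolution.sum {ι : Type*} (F : Finset ι) {g v : ι → ℝ → X}
    (h : ∀ i ∈ F, IsStrictSolution T Y A (g i) (v i)) :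
    IsStrictSolution T Y A (fun t => ∑ i ∈ F, g i t) (fun t => ∑ i ∈ F, v i t) := by
  classical
  induction F using Finset.induction_on with
  | empty => simpa using IsStrictSolution.zero
  | insert i F hi ih =>
    simp_rw [Finset.sum_insert hi]
    exact (h i (Finset.mem_insert_self i F)).add
      (ih fun j hj => h j (Finset.mem_insert_of_mem hj))

/-- A scalar multiple `P(t) U(t, s) y` of an orbit starting in `Y` is a strict solution with
inhomogeneous term `P'(t) U(t, s) y`. -/
theorem isStrictSolution_smul_evolution (hU : IsTwoParameterGroup T U)
    (hYinv : ∀ t ∈ Icc (-T) T, ∀ s ∈ Icc (-T) T, Y.map (U t s : X →ₗ[ℂ] X) = Y)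
    (hA : IsInfinitesimalGenerator T U Y A) {p P : ℝ → ℂ}
    (hP : ∀ t ∈ Icc (-T) T, HasDerivAt P (p t) t) {s : ℝ} (hs : s ∈ Icc (-T) T) (y : Y) :
    IsStrictSolution T Y A (fun t => p t • U t s y) (fun t => P t • U t s y) := by
  have hmem : ∀ t ∈ Icc (-T) T, U t s y ∈ Y := fun t ht => by
    have : U t s y ∈ Y.map (U t s : X →ₗ[ℂ] X) := Submodule.mem_map_of_mem y.2
    rwa [hYinv t ht s hs] at this
  refine ⟨fun t ht => Y.smul_mem _ (hmem t ht), fun t ht => ?_⟩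
  have h1 : HasDerivWithinAt (fun r => U r s y) (A t ⟨U t s y, hmem t ht⟩) (Icc (-T) T) t :=
    (hA t ht ⟨U t s y, hmem t ht⟩).congr (fun r hr => (hU.apply_apply hr ht hs _).symm)
      (hU.apply_apply ht ht hs _).symm
  refine ((hP t ht).hasDerivWithinAt.smul h1).congr_deriv ?_
  have : (⟨P t • U t s y, Y.smul_mem _ (hmem t ht)⟩ : Y) = P t • ⟨U t s y, hmem t ht⟩ := rfl
  rw [this, map_smul]

/-- Continuous functions on a compact interval are uniformly approximated by finite sums
`∑ pᵢ(t) yᵢ` with continuous scalar functions `pᵢ` and `yᵢ` in a given dense subspace. -/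
theorem exists_sum_smul_approx {a b : ℝ} (hab : a < b) {h : ℝ → X} (hh : ContinuousOn h (Icc a b))
    {Y : Submodule ℂ X} (hY : Dense (Y : Set X)) {ε : ℝ} (hε : 0 < ε) :
    ∃ (n : ℕ) (p : Fin n → ℝ → ℂ) (y : Fin n → Y), (∀ i, Continuous (p i)) ∧
      ∀ t ∈ Icc a b, ‖∑ i, p i t • (y i : X) - h t‖ ≤ ε := by
  -- take Bernstein approximations after rescaling to `[0, 1]`, and move the nodal values into `Y`
  let f : C(unitInterval, X) :=
    ⟨fun x => h ((iccHomeoI a b hab).symm x), (continuousOn_iff_continuous_domRestrict.mp hh).comp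
      (iccHomeoI a b hab).symm.continuous⟩
  obtain ⟨n, hn⟩ := ((Metric.tendsto_nhds.mp (bernsteinApproximation_uniform f)) (ε / 2)
    (half_pos hε)).exists
  have hy : ∀ k : Fin (n + 1), ∃ y : Y, ‖(y : X) - f (bernstein.z k)‖ < ε / 2 := fun k => by
    obtain ⟨y, hy, hd⟩ := hY.exists_dist_lt (f (bernstein.z k)) (half_pos hε)
    exact ⟨⟨y, hy⟩, by rwa [dist_comm, dist_eq_norm] at hd⟩
  choose y hy using hy
  let q : ℝ → unitInterval := fun t => iccHomeoI a b hab (projIcc a b hab.le t)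
  have hq : Continuous q := (iccHomeoI a b hab).continuous.comp continuous_projIcc
  refine ⟨n + 1, fun k t => ((bernstein n k (q t) : ℝ) : ℂ), y, fun k => ?_, fun t ht => ?_⟩
  · exact Complex.continuous_ofReal.comp ((bernstein n k).continuous.comp hq)
  have hft : f (q t) = h t := by
    show h ((iccHomeoI a b hab).symm (iccHomeoI a b hab (projIcc a b hab.le t))) = h t
    rw [Homeomorph.symm_apply_apply, projIcc_of_mem hab.le ht]
  have h1 : ‖bernsteinApproximation n f (q t) - h t‖ ≤ ε / 2 := by
    rw [← hft, ← dist_eq_norm]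
    exact (ContinuousMap.dist_apply_le_dist (q t)).trans hn.le
  have h2 : ‖∑ k : Fin (n + 1), ((bernstein n k (q t) : ℝ) : ℂ) • (y k : X)
      - bernsteinApproximation n f (q t)‖ ≤ ε / 2 := by
    rw [bernsteinApproximation.apply, ← Finset.sum_sub_distrib]
    calc _ ≤ ∑ k : Fin (n + 1), bernstein n k (q t) * (ε / 2) := by
          refine norm_sum_le_of_le _ fun k _ => ?_
          rw [Complex.coe_smul, ← smul_sub, norm_smul, Real.norm_of_nonneg bernstein_nonneg]
          exact mul_le_mul_of_nonneg_left (hy k).le bernstein_nonneg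
      _ = ε / 2 := by rw [← Finset.sum_mul, bernstein.probability, one_mul]
  calc _ = ‖(∑ k : Fin (n + 1), ((bernstein n k (q t) : ℝ) : ℂ) • (y k : X)
        - bernsteinApproximation n f (q t)) + (bernsteinApproximation n f (q t) - h t)‖ := by
        rw [sub_add_sub_cancel]
    _ ≤ ε / 2 + ε / 2 := norm_add_le_of_le h2 h1
    _ = ε := add_halves ε

/-- The mild solution `U(t, s) (x + ∫ₛᵗ U(s, τ) f(τ) dτ)` is uniformly close to a strict solution:
replace `x` by an element of `Y`, and `τ ↦ U(s, τ) f(τ)` by a continuous function with values in a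
finite-dimensional subspace of `Y`. -/
theorem exists_strictSolution_near [CompleteSpace X] (hT : 0 < T) (hU : IsTwoParameterGroup T U)
    (hYdense : Dense (Y : Set X))
    (hYinv : ∀ t ∈ Icc (-T) T, ∀ s ∈ Icc (-T) T, Y.map (U t s : X →ₗ[ℂ] X) = Y)
    (hA : IsInfinitesimalGenerator T U Y A) {f : ℝ → X} (hf : ContinuousOn f (Icc (-T) T))
    {s : ℝ} (hs : s ∈ Icc (-T) T) (x : X) {ε : ℝ} (hε : 0 < ε) :
    ∃ g v : ℝ → X, ContinuousOn g (Icc (-T) T) ∧ IsStrictSolution T Y A g v ∧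
      ∀ t ∈ Icc (-T) T, ‖g t - f t‖ ≤ ε ∧
        ‖v t - U t s (x + ∫ τ in s..t, U s τ (f τ))‖ ≤ ε := by
  obtain ⟨K, hK0, hK⟩ := hU.exists_norm_le
  -- the argument of `U t s` will be off by at most `δ + 2Tδ`, which is multiplied by `‖U t s‖ ≤ K`
  set δ := ε / ((K + 1) * (1 + 2 * T)) with hδdef
  have hδ : 0 < δ := by positivity
  have hKδ : K * (δ * (1 + 2 * T)) ≤ ε := by
    rw [hδdef]
    have : K * (ε / ((K + 1) * (1 + 2 * T)) * (1 + 2 * T)) = ε * (K / (K + 1)) := by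
      field_simp
    rw [this]
    exact mul_le_of_le_one_right hε.le ((div_le_one (by positivity)).mpr (by linarith))
  have hKδ' : K * δ ≤ ε := by
    refine le_trans ?_ hKδ
    gcongr
    exact le_mul_of_one_le_right hδ.le (by linarith)
  have hhc := hU.continuousOn_right_apply hs hf
  obtain ⟨n, p, y, hp, hpy⟩ := exists_sum_smul_approx (show -T < T by linarith) hhc hYdense hδ
  obtain ⟨y₀, hy₀, hxy⟩ := hYdense.exists_dist_lt x hδ
  have hP : ∀ i t, HasDerivAt (fun r => ∫ τ in s..r, p i τ) (p i t) t := fun i t =>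
    (hp i).integral_hasStrictDerivAt s t |>.hasDerivAt
  have hgeq : ∀ t, ∑ i, p i t • U t s (y i) = U t s (∑ i, p i t • (y i : X)) := fun t => by
    simp [map_sum]
  have hveq : ∀ t, (1 : ℂ) • U t s y₀ + ∑ i, (∫ τ in s..t, p i τ) • U t s (y i)
      = U t s (y₀ + ∫ τ in s..t, ∑ i, p i τ • (y i : X)) := fun t => by
    have hi : ∀ i ∈ Finset.univ, IntervalIntegrable (fun τ => p i τ • (y i : X)) volume s t :=
      fun i _ => ((hp i).smul continuous_const).intervalIntegrable _ _
    rw [intervalIntegral.integral_finsetSum hi]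
    simp [map_sum, intervalIntegral.integral_smul_const]
  have hcont : Continuous fun t => ∑ i, p i t • (y i : X) :=
    continuous_finsetSum _ fun i _ => (hp i).smul continuous_const
  refine ⟨fun t => (0 : ℂ) • U t s y₀ + ∑ i, p i t • U t s (y i),
    fun t => (1 : ℂ) • U t s y₀ + ∑ i, (∫ τ in s..t, p i τ) • U t s (y i), ?_, ?_, ?_⟩
  · simp only [zero_smul, zero_add, hgeq]
    exact hU.continuousOn_left_apply hs hcont.continuousOn
  · exact (isStrictSolution_smul_evolution hU hYinv hA (p := fun _ => 0) (P := fun _ => 1)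
      (fun t _ => hasDerivAt_const t 1) hs ⟨y₀, hy₀⟩).add
      (IsStrictSolution.sum _ fun i _ =>
        isStrictSolution_smul_evolution hU hYinv hA (fun t _ => hP i t) hs (y i))
  · intro t ht
    have hsub : uIcc s t ⊆ Icc (-T) T := uIcc_subset_Icc hs ht
    constructor
    · simp only [zero_smul, zero_add, hgeq]
      have : f t = U t s (U s t (f t)) := by rw [hU.apply_apply ht hs ht, hU.self_apply ht]
      rw [this, ← map_sub]
      exact ((U t s).le_of_opNorm_le_of_le (hK t ht s hs) (hpy t ht)).trans hKδ'
    · beta_reduce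
      rw [hveq, ← map_sub, add_sub_add_comm, ← intervalIntegral.integral_sub
        (hcont.intervalIntegrable _ _) (hhc.mono hsub).intervalIntegrable]
      refine ((U t s).le_of_opNorm_le_of_le (hK t ht s hs)
        (norm_add_le_of_le (r₁ := δ) (r₂ := δ * (2 * T)) ?_ ?_)).trans ?_
      · rw [← dist_eq_norm, dist_comm]; exact hxy.le
      · refine (intervalIntegral.norm_integral_le_of_norm_le_const
          fun τ hτ => hpy τ (hsub (uIoc_subset_uIcc hτ))).trans ?_
        gcongr
        rw [abs_le]
        constructor <;> linarith [ht.1, ht.2, hs.1, hs.2]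
      · exact le_of_eq_of_le (by ring) hKδ

theorem exists_isSolution [CompleteSpace X] (hT : 0 < T) (hU : IsTwoParameterGroup T U)
    (hYdense : Dense (Y : Set X))
    (hYinv : ∀ t ∈ Icc (-T) T, ∀ s ∈ Icc (-T) T, Y.map (U t s : X →ₗ[ℂ] X) = Y)
    (hA : IsInfinitesimalGenerator T U Y A) {f : ℝ → X} (hf : ContinuousOn f (Icc (-T) T))
    {s : ℝ} (hs : s ∈ Icc (-T) T) (x : X) : ∃ u, IsSolution T Y A f s x u := by
  have hε : ∀ n : ℕ, (0 : ℝ) < 1 / ((n : ℝ) + 1) := fun n => Nat.one_div_pos_of_nat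
  choose g v hg hv hgv using fun n : ℕ =>
    exists_strictSolution_near hT hU hYdense hYinv hA hf hs x (hε n)
  refine ⟨fun t => U t s (x + ∫ τ in s..t, U s τ (f τ)), ?_, ?_, g, v, hg, hv, ?_, ?_⟩
  · refine hU.continuousOn_left_apply hs (continuousOn_const.add ?_)
    have hle : -T ≤ T := by linarith
    have := intervalIntegral.continuousOn_primitive_interval' (μ := volume) (a := s) (b₁ := -T)
      (b₂ := T) (f := fun τ => U s τ (f τ)) ?_ ?_
    · rwa [uIcc_of_le hle] at this
    · exact ContinuousOn.intervalIntegrable_of_Icc hle (hU.continuousOn_right_apply hs hf)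
    · rwa [uIcc_of_le hle]
  · simp [hU.self_apply hs]
  · have hlim : Tendsto (fun n : ℕ => ENNReal.ofReal (1 / ((n : ℝ) + 1)) * volume (Ioo (-T) T))
        atTop (𝓝 0) := by
      have := ENNReal.tendsto_ofReal tendsto_one_div_add_atTop_nhds_zero_nat
      rw [ENNReal.ofReal_zero] at this
      simpa using ENNReal.Tendsto.mul_const this (b := volume (Ioo (-T) T))
        (Or.inr (by simp))
    refine tendsto_of_tendsto_of_tendsto_of_le_of_le tendsto_const_nhds hlim (fun _ => zero_le)
      fun n => ?_
    rw [← setLIntegral_const]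
    refine setLIntegral_mono_ae' measurableSet_Ioo (Eventually.of_forall fun t ht => ?_)
    rw [← ofReal_norm]
    exact ENNReal.ofReal_le_ofReal (hgv n t (Ioo_subset_Icc_self ht)).1
  · rw [Metric.tendstoUniformlyOn_iff]
    intro ε hε0
    filter_upwards [(tendsto_order.mp tendsto_one_div_add_atTop_nhds_zero_nat).2 ε hε0]
      with n hn t ht
    rw [dist_comm, dist_eq_norm]
    exact ((hgv n t ht).2).trans_lt hn

end GeneralizedSolutions

theorem mainTheorem8 {X : Type*} [NormedAddCommGroup X] [NormedSpace ℂ X] [CompleteSpace X]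
    (T : ℝ) (hT : 0 < T) (U : ℝ → ℝ → X →L[ℂ] X) (hU : IsTwoParameterGroup T U)
    (Y : Submodule ℂ X) (hYdense : Dense (Y : Set X))
    (hYinv : ∀ t ∈ Icc (-T) T, ∀ s ∈ Icc (-T) T, Y.map (U t s : X →ₗ[ℂ] X) = Y)
    (A : ℝ → Y →ₗ[ℂ] X) (hA : IsInfinitesimalGenerator T U Y A) :
    ∃ (κ c : ℂ) (R : ℝ), κ ≠ 0 ∧ 0 < R ∧
      -- the circle and its interior avoid the origin and the cut of `Log`
      Metric.closedBall c R ⊆ Complex.slitPlane ∧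
      -- the circle encloses the spectrum of `U(t, s) + κ I`, for all `t`, `s`
      (∀ t ∈ Icc (-T) T, ∀ s ∈ Icc (-T) T,
        spectrum ℂ (U t s + κ • ContinuousLinearMap.id ℂ X) ⊆ Metric.ball c R) ∧
      (∀ t ∈ Icc (-T) T, ∀ s ∈ Icc (-T) T,
        Summable (fun n => ‖expTerm (logEvolution U κ c R t s) n‖)) ∧
      ∀ f : ℝ → X, IntegrableOn f (Ioo (-T) T) → IsLocallyHolderOn f (Icc (-T) T) →
      ∀ s ∈ Icc (-T) T, ∀ x : X,
      ∃ u : ℝ → X, IsSolution T Y A f s x u ∧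
        (∀ v : ℝ → X, IsSolution T Y A f s x v → EqOn v u (Icc (-T) T)) ∧
        ∀ t ∈ Icc (-T) T,
          IntervalIntegrable
            (fun τ => (∑' n, expTerm (logEvolution U κ c R t τ) n) (f τ) - κ • f τ)
            volume s t ∧
          u t = ((∑' n, expTerm (logEvolution U κ c R t s) n) x - κ • x) +
            ∫ τ in s..t, ((∑' n, expTerm (logEvolution U κ c R t τ) n) (f τ) - κ • f τ) := by
  -- with `‖U(t, s)‖ ≤ K`, take `R = K + 1` and `c = κ = K + 2`: the circle encloses the spectrum,
  -- and its disc lies in the half-plane `1 ≤ re z`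
  obtain ⟨K, hK0, hK⟩ := hU.exists_norm_le
  have hKR : ∀ t ∈ Icc (-T) T, ∀ s ∈ Icc (-T) T, ‖U t s‖ < K + 1 := fun t ht s hs =>
    (hK t ht s hs).trans_lt (lt_add_one K)
  -- subtracting `κ` from the exponential of the logarithm gives back `U(t, s)`
  have hexp : ∀ t ∈ Icc (-T) T, ∀ s ∈ Icc (-T) T, ∀ y,
      (∑' n, expTerm (logEvolution U ((K + 2 : ℝ) : ℂ) ((K + 2 : ℝ) : ℂ) (K + 1) t s) n) y
        - ((K + 2 : ℝ) : ℂ) • y = U t s y := fun t ht s hs y => by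
    have h := exp_dunfordLog (κ := K + 2) (by linarith) (hKR t ht s hs)
    rw [NormedSpace.exp_eq_tsum ℂ] at h
    have h' := congrArg (fun B : X →L[ℂ] X => B y) h
    exact sub_eq_of_eq_add h'
  refine ⟨((K + 2 : ℝ) : ℂ), ((K + 2 : ℝ) : ℂ), K + 1, ?_, by linarith, ?_, ?_, ?_, ?_⟩
  · exact_mod_cast (by linarith : K + 2 ≠ 0)
  · intro z hz
    left
    have h2 := (abs_le.mp
      ((Complex.abs_re_le_norm _).trans (mem_closedBall_iff_norm.mp hz))).1
    rw [Complex.sub_re, Complex.ofReal_re] at h2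
    linarith
  · intro t ht s hs z hz
    have hid : ((K + 2 : ℝ) : ℂ) • ContinuousLinearMap.id ℂ X
        = algebraMap ℂ (X →L[ℂ] X) ((K + 2 : ℝ) : ℂ) := by
      rw [Algebra.algebraMap_eq_smul_one]; rfl
    rw [hid, add_comm, ← sub_add_cancel z ((K + 2 : ℝ) : ℂ), spectrum.add_mem_add_iff] at hz
    rw [mem_ball_iff_norm]
    exact ((spectrum.norm_le_norm_mul_of_mem hz).trans (mul_le_of_le_one_right (norm_nonneg _)
      ContinuousLinearMap.norm_id_le)).trans_lt (hKR t ht s hs)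
  · exact fun t _ s _ => NormedSpace.norm_expSeries_summable' _
  · intro f _ hfH s hs x
    have hf := hfH.continuousOn
    obtain ⟨u, hu⟩ := exists_isSolution hT hU hYdense hYinv hA hf hs x
    refine ⟨u, hu, fun v hv t ht => ?_, fun t ht => ?_⟩
    · rw [hv.eq_duhamel hU hA hf ht hs, hu.eq_duhamel hU hA hf ht hs]
    · have hsub : uIcc s t ⊆ Icc (-T) T := uIcc_subset_Icc hs ht
      have heq : EqOn (fun τ => (∑' n, expTerm (logEvolution U ((K + 2 : ℝ) : ℂ)
          ((K + 2 : ℝ) : ℂ) (K + 1) t τ) n) (f τ) - ((K + 2 : ℝ) : ℂ) • f τ)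
          (fun τ => U t τ (f τ)) (uIcc s t) := fun τ hτ => hexp t ht τ (hsub hτ) (f τ)
      constructor
      · exact (((hU.continuousOn_right_apply ht hf).mono hsub).congr heq).intervalIntegrable
      · rw [intervalIntegral.integral_congr heq, hexp t ht s hs]
        exact hu.eq_duhamel hU hA hf ht hs
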